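/- **Conventions.** Let $n$ be a positive integer. For $a\in\mathbb Z^n$, $\ell\in\mathbb N^n$ put $P_{a,\ell}=\{x\in\mathbb Z^n: a_k\le x_k<a_k+\ell_k \text{ for all } k\}$. A set $A\subset\mathbb Z^n$ is *frequency measurable* with frequency $\mathbf F(A)=p$ if $\#(A\cap P_{a,\ell})/\#P_{a,\ell}\to p$ as $\min_k\ell_k\to\infty$, uniformly in $a$. A subset of $\mathbb R^m$ is *Jordan measurable* if it is bounded and its boundary has Lebesgue measure zero. A *quantizer* is a map $R:\mathbb R^n\to\mathbb Z^n$ such that $R(u+z)=R(u)+z$ for all $u\in\mathbb R^n$, $z\in\mathbb Z^n$ and $R^{-1}(0)$ is Jordan measurable. A nonsingular matrix $L\in\mathbb R^{n\times n}$ is *iteratively nonresonant* if, for every matrix $\Lambda$ formed from finitely many different rows of the stack of all powers $L^j$, $j\in\mathbb Z\setminus\{0\}$, the rows of $\begin{bmatrix}I_n\\ \Lambda\end{bmatrix}$ are linearly independent over $\mathbb Q$. Let $R$ be a quantizer and $L\in\mathbb R^{n\times n}$ a nonsingular matrix. Put $T(x)=R(Lx)$ for $x\in\mathbb Z^n$ and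 $\mu=\int_{R^{-1}(0)}u\,du$. The *compensating system* $(\widetilde R,L^{-1})$ has the quantizer $\widetilde R(u)=R(u+(I_n+L^{-1})\mu)$ and the transition operator $\widetilde T(x)=\widetilde R(L^{-1}x)$. For $N\ge1$ and $x\in\mathbb Z^n$ put $T^{-N}(x)=\{y\in\mathbb Z^n:T^N(y)=x\}$ and $$\Sigma_N(x)=T^{-N}(x)-\widetilde T^N(x),\qquad\text{so that } T^{-N}(x)=\widetilde T^N(x)+\Sigma_N(x).$$ Let $\mathcal Q_N^-$ be the class of the sets $\{x\in\mathbb Z^n:\mathcal L_N^-x\in G+\mathbb Z^{Nn}\}$, where $\mathcal L_N^-\in\mathbb R^{Nn\times n}$ is formed from the blocks $L^{-N},\dots,L^{-1}$ stacked one underneath the other and $G$ ranges over the Jordan measurable subsets of $[0,1)^{Nn}$. For finite sets $A,B\subset\mathbb Z^n$ put $$\Delta(B\mid A)=\mathrm{mes}_n\left\{u\in\widetilde R^{-1}(0):\ \mathbb Z^n\cap\left(u+L^{-1}(A+R^{-1}(0))\right)=B\right\}.$$ **Theorem.** Suppose that $L$ is iteratively nonresonant. Then the sequence $(\Sigma_N)_{N\ge1}$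 of maps from $\mathbb Z^n$ to the class of finite subsets of $\mathbb Z^n$ is a homogeneous Markov chain with respect to the filtration $(\mathcal Q_N^-)_{N\ge1}$, with transition kernel $\Delta(\cdot\mid\cdot)$. That is, every $\mathcal Q_N^-$ is an algebra of frequency measurable subsets of $\mathbb Z^n$ and $\mathcal Q_N^-\subset\mathcal Q_{N+1}^-$; $\Delta(\cdot\mid A)\ge0$ and $\sum_B\Delta(B\mid A)=1$ for every finite $A\subset\mathbb Z^n$ (the sum is over the finite $B\subset\mathbb Z^n$); every set $\Sigma_N(x)$ is finite; and for all $N\ge1$, $E\in\mathcal Q_N^-$ and finite $B,C\subset\mathbb Z^n$ one has $\Sigma_N^{-1}(B)=\{x:\Sigma_N(x)=B\}\in\mathcal Q_N^-$ and $$\mathbf F\left(E\cap\Sigma_N^{-1}(B)\cap\Sigma_{N+1}^{-1}(C)\right)=\mathbf F\left(E\cap\Sigma_N^{-1}(B)\right)\,\Delta(C\mid B).$$ Moreover, for every $N\ge1$ and all finite sets $B_1,\dots,B_N\subset\mathbb Z^n$, $$\bigcap_{k=1}^N\Sigma_k^{-1}(B_k)\in\mathcal Q_N^-\qquad\text{and}\qquad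 \mathbf F\left(\bigcap_{k=1}^N\Sigma_k^{-1}(B_k)\right)=\prod_{k=1}^N\Delta(B_k\mid B_{k-1}),\qquad B_0:=\{0\}.$$ All the frequencies above exist. -/

import Mathlib

open MeasureTheory Filter Topology

noncomputable section

namespace QuantizedLinear

/-- The inclusion of the integer lattice into real space. -/
def toReal {ι : Type*} (z : ι → ℤ) : ι → ℝ := fun i => (z i : ℝ)

/-! ### Frequencies of subsets of the lattice -/

/-- The discrete parallelepiped of the lattice points `x` with `a k ≤ x k < a k + ℓ k`. -/
def box {n : ℕ} (a : Fin n → ℤ) (ℓ : Fin n → ℕ) : Set (Fin n → ℤ) :=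
  {x | ∀ k, a k ≤ x k ∧ x k < a k + (ℓ k : ℤ)}

/-- The fraction of points of `A` in a discrete parallelepiped. -/
def fraction {n : ℕ} (A : Set (Fin n → ℤ)) (a : Fin n → ℤ) (ℓ : Fin n → ℕ) : ℝ :=
  ((A ∩ box a ℓ).ncard : ℝ) / ((box a ℓ).ncard : ℝ)

/-- `A` is frequency measurable with frequency `p`: the fraction of points of `A` in a discrete
parallelepiped tends to `p` as the smallest edge length tends to infinity, uniformly in the
position `a` of the parallelepiped. -/
def HasFrequency {n : ℕ} (A : Set (Fin n → ℤ)) (p : ℝ) : Prop :=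
  Tendsto (fun q : (Fin n → ℤ) × (Fin n → ℕ) => fraction A q.1 q.2)
    ((⊤ : Filter (Fin n → ℤ)) ×ˢ (atTop : Filter (Fin n → ℕ))) (𝓝 p)

/-! ### Quasiperiodic sets -/

/-- Jordan measurability: boundedness together with a boundary of Lebesgue measure zero. -/
def JordanMeasurable {ι : Type*} [Fintype ι] (G : Set (ι → ℝ)) : Prop :=
  Bornology.IsBounded G ∧ volume (frontier G) = 0

/-- The set of the lattice points `x` with `Λ x ∈ G + ℤ^m`. -/
def quasiperiodicSet {n : ℕ} {ι : Type*} (G : Set (ι → ℝ)) (Λ : Matrix ι (Fin n) ℝ) :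
    Set (Fin n → ℤ) :=
  {x | ∃ g ∈ G, ∃ z : ι → ℤ, Λ.mulVec (toReal x) = g + toReal z}

/-- The class of `Λ`-quasiperiodic sets, with `G` a Jordan measurable subset of `[0,1)^m`. -/
def quasiperiodicAlgebra {n : ℕ} {ι : Type*} [Fintype ι] (Λ : Matrix ι (Fin n) ℝ) :
    Set (Set (Fin n → ℤ)) :=
  {A | ∃ G : Set (ι → ℝ), G ⊆ Set.univ.pi (fun _ => Set.Ico (0 : ℝ) 1) ∧
    JordanMeasurable G ∧ A = quasiperiodicSet G Λ}

/-- The matrix formed from the blocks `L⁻¹, …, L^(-N)` stacked one under another. -/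
def backwardMatrix {n : ℕ} (L : Matrix (Fin n) (Fin n) ℝ) (N : ℕ) :
    Matrix (Fin N × Fin n) (Fin n) ℝ :=
  Matrix.of fun r j => (L ^ (-((r.1 : ℕ) + 1 : ℤ))) r.2 j

/-- The algebra of quasiperiodic sets generated by `L⁻¹, …, L^(-N)`. -/
def backwardAlgebra {n : ℕ} (L : Matrix (Fin n) (Fin n) ℝ) (N : ℕ) : Set (Set (Fin n → ℤ)) :=
  quasiperiodicAlgebra (backwardMatrix L N)

/-! ### Nonresonance -/

/-- The rows of the identity matrix and the rows of `Λ` together are rationally independent. -/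
def Nonresonant {n : ℕ} {ι : Type*} (Λ : Matrix ι (Fin n) ℝ) : Prop :=
  LinearIndependent ℚ (Matrix.fromRows (1 : Matrix (Fin n) (Fin n) ℝ) Λ).row

/-- The infinite matrix formed from all nonzero integer powers of `L`. -/
def powersMatrix {n : ℕ} (L : Matrix (Fin n) (Fin n) ℝ) :
    Matrix ({j : ℤ // j ≠ 0} × Fin n) (Fin n) ℝ :=
  Matrix.of fun r j => (L ^ (r.1 : ℤ)) r.2 j

/-- A nonsingular matrix `L` is iteratively nonresonant if every matrix made of finitely many
different rows of `powersMatrix L` is nonresonant. -/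
def IterativelyNonresonant {n : ℕ} (L : Matrix (Fin n) (Fin n) ℝ) : Prop :=
  L.det ≠ 0 ∧ ∀ (m : ℕ) (s : Fin m → {j : ℤ // j ≠ 0} × Fin n), Function.Injective s →
    Nonresonant ((powersMatrix L).submatrix s id)

/-! ### Quantized linear systems and the compensating system -/

/-- A quantizer commutes with integer translations and has a Jordan measurable cell `R⁻¹(0)`. -/
structure IsQuantizer {n : ℕ} (R : (Fin n → ℝ) → (Fin n → ℤ)) : Prop where
  map_add : ∀ (u : Fin n → ℝ) (z : Fin n → ℤ), R (u + toReal z) = R u + z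
  jordan : JordanMeasurable (R ⁻¹' {0})

/-- The transition operator `T = R ∘ L` of the quantized linear `(R, L)`-system. -/
def transition {n : ℕ} (R : (Fin n → ℝ) → (Fin n → ℤ)) (L : Matrix (Fin n) (Fin n) ℝ) :
    (Fin n → ℤ) → (Fin n → ℤ) :=
  fun x => R (L.mulVec (toReal x))

/-- The mean vector of the uniform distribution over the cell `R⁻¹(0)`. -/
def cellMean {n : ℕ} (R : (Fin n → ℝ) → (Fin n → ℤ)) : Fin n → ℝ :=
  ∫ u in R ⁻¹' {0}, u

/-- The quantizer of the compensating system. -/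
def compQuantizer {n : ℕ} (R : (Fin n → ℝ) → (Fin n → ℤ)) (L : Matrix (Fin n) (Fin n) ℝ) :
    (Fin n → ℝ) → (Fin n → ℤ) :=
  fun u => R (u + (1 + L⁻¹).mulVec (cellMean R))

/-- The transition operator of the compensating system. -/
def compTransition {n : ℕ} (R : (Fin n → ℝ) → (Fin n → ℤ)) (L : Matrix (Fin n) (Fin n) ℝ) :
    (Fin n → ℤ) → (Fin n → ℤ) :=
  transition (compQuantizer R L) L⁻¹

/-- The set `Σ_N(x)`: the `N`-step preimage of `x` under the transition operator, translated by
minus the `N`-th iterate of the compensating system at `x`. -/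
def basinSet {n : ℕ} (R : (Fin n → ℝ) → (Fin n → ℤ)) (L : Matrix (Fin n) (Fin n) ℝ)
    (N : ℕ) (x : Fin n → ℤ) : Set (Fin n → ℤ) :=
  (fun y => y - (compTransition R L)^[N] x) '' {y | (transition R L)^[N] y = x}

/-- The set `ℤ^n ∩ (u + L⁻¹ (A + R⁻¹(0)))`. -/
def latticeStep {n : ℕ} (R : (Fin n → ℝ) → (Fin n → ℤ)) (L : Matrix (Fin n) (Fin n) ℝ)
    (A : Set (Fin n → ℤ)) (u : Fin n → ℝ) : Set (Fin n → ℤ) :=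
  {z | ∃ a ∈ A, ∃ v ∈ R ⁻¹' {0}, toReal z = u + (L⁻¹).mulVec (toReal a + v)}

/-- The transition kernel: `kernel R L A B` is the probability `Δ(B | A)` of passing from
`A` to `B`. -/
def kernel {n : ℕ} (R : (Fin n → ℝ) → (Fin n → ℤ)) (L : Matrix (Fin n) (Fin n) ℝ)
    (A B : Finset (Fin n → ℤ)) : ℝ :=
  volume.real {u : Fin n → ℝ | u ∈ compQuantizer R L ⁻¹' {0} ∧ latticeStep R L ↑A u = ↑B}

/-! ### Markov chains on the lattice -/

/-- The sequence `X 1, X 2, …` of maps from the lattice to its finite subsets is a homogeneous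
Markov chain with respect to the filtration `𝓕 1 ⊆ 𝓕 2 ⊆ …` of algebras of frequency measurable
sets, with transition kernel `K` (`K A B` is the probability of passing from `A` to `B`).
The conditional probability of `{X (N+1) = C}` given an event `E ∈ 𝓕 N` and `{X N = B}` is
`K B C`; this is written in product form, so that events of zero frequency need no exception. -/
structure IsHomogeneousMarkovChain {n : ℕ} (𝓕 : ℕ → Set (Set (Fin n → ℤ)))
    (X : ℕ → (Fin n → ℤ) → Set (Fin n → ℤ))
    (K : Finset (Fin n → ℤ) → Finset (Fin n → ℤ) → ℝ) : Prop where
  algebra : ∀ N, 1 ≤ N → IsSetAlgebra (𝓕 N)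
  mono : ∀ N, 1 ≤ N → 𝓕 N ⊆ 𝓕 (N + 1)
  measurable : ∀ N, 1 ≤ N → ∀ E ∈ 𝓕 N, ∃ p, HasFrequency E p
  kernel_nonneg : ∀ A B, 0 ≤ K A B
  kernel_sum : ∀ A, HasSum (fun B => K A B) 1
  finite : ∀ N, 1 ≤ N → ∀ x, (X N x).Finite
  adapted : ∀ N, 1 ≤ N → ∀ B : Finset (Fin n → ℤ), {x | X N x = ↑B} ∈ 𝓕 N
  markov : ∀ N, 1 ≤ N → ∀ E ∈ 𝓕 N, ∀ (B C : Finset (Fin n → ℤ)) (p : ℝ),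
    HasFrequency (E ∩ {x | X N x = ↑B}) p →
      HasFrequency (E ∩ {x | X N x = ↑B} ∩ {x | X (N + 1) x = ↑C}) (p * K B C)

end QuantizedLinear

end

namespace QuantizedLinear

/-! ### Almost everywhere locally constant functions -/

/-! Put w = T̃^N(x). Then L(z + T̃w) = L(z − e) + w, where e is the quantization error of R̃ at
L⁻¹w. Equivariance of R therefore makes Σ_{N+1}(x) the `latticeStep` of Σ_N(x) at e
(`basinSet_succ`). Unrolling this recursion, Σ_N(x) becomes a function of the stack (L⁻¹x, …,
L^(-N)x) that is invariant under integer translations and locally constant almost everywhere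
(`basinSet_eq_basinLift`, `aeLocConst_basinLift`). Predicates of that kind describe exactly the sets
of the algebra (`mem_quasiperiodicAlgebra_iff`), so Σ_N is adapted.

By nonresonance and Weyl's criterion the stack is equidistributed modulo 1, so the frequency of such
a set is a volume in the unit cube (`Nonresonant.hasFrequency`).

The step from N to N + 1 adds the block L^(-N-1)x, which is uniform and independent of the earlier
blocks. The error e is that of R̃ at this block minus a shift depending only on the earlier blocks.
Uniform measure on the torus is translation invariant, so given the past e is still uniform on the
cell of R̃, and the conditional law of Σ_{N+1} is Δ (`volume_skew`, `hasFrequency_basinSet_succ`).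
The path formula follows by induction from Σ_0 = {0}. -/

/-- A function which is locally constant near almost every point. -/
def AELocConst {X Z : Type*} [TopologicalSpace X] [MeasureSpace X] (f : X → Z) : Prop :=
  ∀ᵐ x, ∀ᶠ y in 𝓝 x, f y = f x

/-- Openness makes this set Borel for an arbitrary `f`, which is what lets Fubini apply in
`AELocConst.of_ae_ae`. -/
lemma isOpen_setOf_eventually_eq {X Z : Type*} [TopologicalSpace X] (f : X → Z) :
    IsOpen {x | ∀ᶠ y in 𝓝 x, f y = f x} := by
  rw [isOpen_iff_mem_nhds]
  intro x hx
  have hx' : ∀ᶠ y in 𝓝 x, f y = f x := hx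
  filter_upwards [hx'.eventually_nhds, hx'] with y hy hyx
  filter_upwards [hy] with w hw
  rw [hw, hyx]

namespace AELocConst

variable {X Z W : Type*} [TopologicalSpace X] [MeasureSpace X]

lemma const (c : Z) : AELocConst (fun _ : X => c) := by simp [AELocConst]

lemma comp {f : X → Z} (hf : AELocConst f) (g : Z → W) : AELocConst (fun x => g (f x)) := by
  filter_upwards [hf] with x hx
  filter_upwards [hx] with y hy
  rw [hy]

lemma prodMk {f : X → Z} {g : X → W} (hf : AELocConst f) (hg : AELocConst g) :
    AELocConst (fun x => (f x, g x)) := by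
  filter_upwards [hf, hg] with x hx hx'
  filter_upwards [hx, hx'] with y hy hy'
  rw [hy, hy']

lemma and {P Q : X → Prop} (hP : AELocConst P) (hQ : AELocConst Q) :
    AELocConst (fun x => P x ∧ Q x) :=
  (hP.prodMk hQ).comp fun p => p.1 ∧ p.2

lemma or {P Q : X → Prop} (hP : AELocConst P) (hQ : AELocConst Q) :
    AELocConst (fun x => P x ∨ Q x) :=
  (hP.prodMk hQ).comp fun p => p.1 ∨ p.2

lemma not {P : X → Prop} (hP : AELocConst P) : AELocConst (fun x => ¬ P x) := hP.comp Not

lemma eq_const {f : X → Z} (hf : AELocConst f) (c : Z) : AELocConst (fun x => f x = c) :=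
  hf.comp fun z => z = c

lemma comp_quasiMeasurePreserving {Y : Type*} [TopologicalSpace Y] [MeasureSpace Y] {f : X → Z}
    (hf : AELocConst f) {g : Y → X} (hg : Continuous g)
    (hg' : Measure.QuasiMeasurePreserving g volume volume) : AELocConst (fun y => f (g y)) := by
  filter_upwards [hg'.ae hf] with y hy
  exact hg.continuousAt.eventually hy

/-- Near a frontier point `P` both holds and fails, so it is not locally constant there. With
`of_volume_frontier`, the null boundary condition becomes closed under logical operations. -/
lemma volume_frontier {P : X → Prop} (hP : AELocConst P) : volume (frontier {x | P x}) = 0 := by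
  refine measure_mono_null (fun x hx => ?_) (ae_iff.1 hP)
  intro h
  rw [frontier_eq_closure_inter_closure] at hx
  obtain ⟨y, hy, hy'⟩ := (mem_closure_iff_frequently.1 hx.1).and_eventually h |>.exists
  obtain ⟨z, hz, hz'⟩ := (mem_closure_iff_frequently.1 hx.2).and_eventually h |>.exists
  simp only [Set.mem_ofPred_eq] at hy
  simp only [Set.mem_compl_iff, Set.mem_ofPred_eq] at hz
  rw [hy'] at hy
  rw [hz'] at hz
  exact hz hy

lemma of_volume_frontier {s : Set X} (hs : volume (frontier s) = 0) :
    AELocConst (fun x => x ∈ s) := by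
  have : ∀ᵐ x, x ∉ frontier s := measure_eq_zero_iff_ae_notMem.1 hs
  filter_upwards [this] with x hx
  by_cases h : x ∈ s
  · have : s ∈ 𝓝 x := by
      by_contra h'
      exact hx ⟨subset_closure h, fun h'' => h' (mem_interior_iff_mem_nhds.1 h'')⟩
    filter_upwards [this] with y hy
    simp [h, hy]
  · have : sᶜ ∈ 𝓝 x := by
      by_contra h'
      rw [← frontier_compl] at hx
      exact hx ⟨subset_closure h, fun h'' => h' (mem_interior_iff_mem_nhds.1 h'')⟩
    filter_upwards [this] with y hy
    simp only [Set.mem_compl_iff] at hy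
    simp [h, hy]

variable [BorelSpace X]

lemma nullMeasurableSet {P : X → Prop} (hP : AELocConst P) :
    NullMeasurableSet {x | P x} :=
  nullMeasurableSet_of_null_frontier hP.volume_frontier

lemma volume_eq_tsum [Countable Z] {f : X → Z} (hf : AELocConst f) {P : X → Prop}
    (hP : AELocConst P) : volume {x | P x} = ∑' z, volume {x | P x ∧ f x = z} := by
  have : {x | P x} = ⋃ z, {x | P x ∧ f x = z} := by ext x; simp
  rw [this, measure_iUnion₀]
  · intro z w hzw
    refine Disjoint.aedisjoint (Set.disjoint_left.2 ?_)
    rintro x ⟨_, h⟩ ⟨_, h'⟩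
    exact hzw (h.symm.trans h')
  · exact fun z => (hP.and (hf.eq_const z)).nullMeasurableSet

end AELocConst

/-! ### Equivariant and periodic maps under integer translations -/

lemma toReal_add {ι : Type*} (z w : ι → ℤ) : toReal (z + w) = toReal z + toReal w := by
  ext i; simp [toReal]

lemma toReal_neg {ι : Type*} (z : ι → ℤ) : toReal (-z) = -toReal z := by
  ext i; simp [toReal]

lemma toReal_zero {ι : Type*} : toReal (0 : ι → ℤ) = 0 := by
  ext i; simp [toReal]

/-- Equivariance of a map to the lattice under the integer translations. -/
def Equivariant {ι : Type*} (f : (ι → ℝ) → (ι → ℤ)) : Prop :=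
  ∀ (u : ι → ℝ) (z : ι → ℤ), f (u + toReal z) = f u + z

/-- Invariance under the integer translations. -/
def Periodic {ι Z : Type*} (f : (ι → ℝ) → Z) : Prop :=
  ∀ (u : ι → ℝ) (z : ι → ℤ), f (u + toReal z) = f u

lemma Equivariant.periodic_frac {ι : Type*} {f : (ι → ℝ) → (ι → ℤ)} (hf : Equivariant f) :
    Periodic (fun u => u - toReal (f u)) := by
  intro u z
  simp only [hf u z, toReal_add]
  abel

/-- The lattice is countable, so almost every `u` has all its integer translates off the frontier of
the zero cell. The translate by `-f u` lies in the cell, hence in its interior. -/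
lemma Equivariant.aeLocConst {ι : Type*} [Fintype ι] {f : (ι → ℝ) → (ι → ℤ)}
    (hf : Equivariant f) (h : volume (frontier (f ⁻¹' {0})) = 0) : AELocConst f := by
  have h1 : ∀ᵐ u : ι → ℝ, ∀ z : ι → ℤ, u + toReal z ∉ frontier (f ⁻¹' {0}) := by
    refine ae_all_iff.2 fun z => ?_
    exact (measurePreserving_add_right volume (toReal z)).quasiMeasurePreserving.ae
      (measure_eq_zero_iff_ae_notMem.1 h)
  filter_upwards [h1] with u hu
  have h2 : f (u + toReal (-(f u))) = 0 := by rw [hf]; simp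
  have h3 : f ⁻¹' {0} ∈ 𝓝 (u + toReal (-(f u))) := by
    by_contra h'
    exact hu (-(f u)) ⟨subset_closure h2, fun h'' => h' (mem_interior_iff_mem_nhds.1 h'')⟩
  have h4 : Tendsto (fun v => v + toReal (-(f u))) (𝓝 u) (𝓝 (u + toReal (-(f u)))) :=
    (continuous_add_const _).continuousAt
  filter_upwards [h4 h3] with v hv
  have : f (v + toReal (-(f u))) = 0 := hv
  rw [hf] at this
  rwa [← sub_eq_add_neg, sub_eq_zero] at this

/-! ### The unit cube -/

/-- The coordinatewise floor. -/
noncomputable def floorPi {ι : Type*} (u : ι → ℝ) : ι → ℤ := fun i => ⌊u i⌋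

/-- The half-open unit cube. -/
def cube (ι : Type*) : Set (ι → ℝ) := Set.univ.pi fun _ => Set.Ico (0 : ℝ) 1

lemma equivariant_floorPi {ι : Type*} : Equivariant (floorPi (ι := ι)) := by
  intro u z; ext i; simp [floorPi, toReal]

lemma floorPi_preimage_zero {ι : Type*} : floorPi ⁻¹' {(0 : ι → ℤ)} = cube ι := by
  ext u
  simp only [floorPi, cube, Set.mem_preimage, Set.mem_singleton_iff, funext_iff, Set.mem_pi,
    Set.mem_univ, forall_const, Pi.zero_apply, Int.floor_eq_zero_iff]

lemma mem_cube_iff {ι : Type*} {u : ι → ℝ} : u ∈ cube ι ↔ floorPi u = 0 := by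
  rw [← floorPi_preimage_zero]; rfl

lemma aeLocConst_floorPi {ι : Type*} [Fintype ι] : AELocConst (floorPi (ι := ι)) := by
  refine equivariant_floorPi.aeLocConst ?_
  rw [floorPi_preimage_zero]
  exact (convex_pi fun i _ => convex_Ico 0 1).addHaar_frontier _

lemma sub_floorPi_mem_cube {ι : Type*} (u : ι → ℝ) : u - toReal (floorPi u) ∈ cube ι := by
  rw [mem_cube_iff, sub_eq_add_neg, ← toReal_neg, equivariant_floorPi, add_neg_cancel]

lemma isBounded_cube {ι : Type*} [Fintype ι] : Bornology.IsBounded (cube ι) :=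
  Bornology.IsBounded.pi fun _ => Metric.isBounded_Ico 0 1

lemma measurableSet_cube {ι : Type*} [Fintype ι] : MeasurableSet (cube ι) :=
  MeasurableSet.univ_pi fun _ => measurableSet_Ico

lemma volume_cube {ι : Type*} [Fintype ι] : volume (cube ι) = 1 := by
  simp [cube, volume_pi_pi]

/-- Two equivariant maps to the lattice have zero cells which meet an invariant set in sets of the
same volume. -/
lemma volume_cell_eq {ι : Type*} [Fintype ι] {f g : (ι → ℝ) → (ι → ℤ)} (hf : Equivariant f)
    (hg : Equivariant g) (hf' : AELocConst f) (hg' : AELocConst g) {Q : (ι → ℝ) → Prop}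
    (hQ : Periodic Q) (hQ' : AELocConst Q) :
    volume {u | Q u ∧ f u = 0} = volume {u | Q u ∧ g u = 0} := by
  -- Each cell is cut by the values of the other map; the piece f = 0, g = -z is an integer
  -- translate of the piece g = 0, f = z.
  rw [hg'.volume_eq_tsum (hQ'.and (hf'.eq_const 0)), hf'.volume_eq_tsum (hQ'.and (hg'.eq_const 0)),
    ← (Equiv.neg (ι → ℤ)).tsum_eq]
  refine tsum_congr fun z => ?_
  rw [← measure_preimage_add_right volume (toReal (-z))]
  congr 1
  ext u
  simp only [Equiv.neg_apply, Set.preimage_ofPred_eq, Set.mem_ofPred_eq, hQ u, hf u, hg u]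
  constructor
  · rintro ⟨⟨h1, h2⟩, h3⟩
    exact ⟨⟨h1, by simpa using h3⟩, by rwa [← sub_eq_add_neg, sub_eq_zero] at h2⟩
  · rintro ⟨⟨h1, h2⟩, h3⟩
    exact ⟨⟨h1, by simp [h3]⟩, by simp [h2]⟩

/-! ### Quasiperiodic sets as periodic predicates -/

/-- A Jordan set in the unit cube extends periodically, and a periodic predicate restricts to the
cube. No property of `Λ` is involved. -/
lemma mem_quasiperiodicAlgebra_iff {n : ℕ} {ι : Type*} [Fintype ι] {Λ : Matrix ι (Fin n) ℝ}
    {A : Set (Fin n → ℤ)} : A ∈ quasiperiodicAlgebra Λ ↔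
      ∃ P : (ι → ℝ) → Prop, Periodic P ∧ AELocConst P ∧ A = {x | P (Λ.mulVec (toReal x))} := by
  constructor
  · rintro ⟨G, hG, hG', rfl⟩
    have key : ∀ y : ι → ℝ, (∃ g ∈ G, ∃ z : ι → ℤ, y = g + toReal z) ↔
        y - toReal (floorPi y) ∈ G := by
      intro y
      constructor
      · rintro ⟨g, hg, z, rfl⟩
        have : floorPi g = 0 := mem_cube_iff.1 (hG hg)
        rwa [equivariant_floorPi, this, zero_add, add_sub_cancel_right]
      · intro h
        exact ⟨_, h, floorPi y, by simp⟩
    refine ⟨fun y => y - toReal (floorPi y) ∈ G, ?_, ?_, ?_⟩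
    · intro u z
      simp only [equivariant_floorPi.periodic_frac u z]
    · have h1 : ∀ᵐ u : ι → ℝ, ∀ z : ι → ℤ,
          ∀ᶠ v in 𝓝 (u - toReal z), (v ∈ G) = (u - toReal z ∈ G) :=
        ae_all_iff.2 fun z => (measurePreserving_sub_right volume
          (toReal z)).quasiMeasurePreserving.ae (AELocConst.of_volume_frontier hG'.2)
      filter_upwards [h1, aeLocConst_floorPi] with u hu hu'
      have h4 : Tendsto (fun v => v - toReal (floorPi u)) (𝓝 u) (𝓝 (u - toReal (floorPi u))) :=
        (continuous_sub_right _).continuousAt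
      filter_upwards [hu', h4.eventually (hu (floorPi u))] with v hv hv'
      rw [hv, hv']
    · ext x
      exact key _
  · rintro ⟨P, hP, hP', rfl⟩
    refine ⟨{g | P g ∧ g ∈ cube ι}, fun g hg => hg.2, ⟨isBounded_cube.subset fun g hg => hg.2, ?_⟩,
      ?_⟩
    · simp only [mem_cube_iff]
      exact (hP'.and (aeLocConst_floorPi.eq_const 0)).volume_frontier
    · ext x
      simp only [Set.mem_ofPred_eq, quasiperiodicSet]
      constructor
      · intro h
        refine ⟨_, ⟨?_, sub_floorPi_mem_cube (Λ.mulVec (toReal x))⟩, floorPi _,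
          (sub_add_cancel _ _).symm⟩
        rwa [sub_eq_add_neg, ← toReal_neg, hP]
      · rintro ⟨g, hg, z, h⟩
        rw [h, hP]
        exact hg.1

lemma isSetAlgebra_quasiperiodicAlgebra {n : ℕ} {ι : Type*} [Fintype ι]
    (Λ : Matrix ι (Fin n) ℝ) : IsSetAlgebra (quasiperiodicAlgebra Λ) where
  empty_mem := mem_quasiperiodicAlgebra_iff.2
    ⟨fun _ => False, fun _ _ => rfl, AELocConst.const _, by simp⟩
  compl_mem s hs := by
    obtain ⟨P, hP, hP', rfl⟩ := mem_quasiperiodicAlgebra_iff.1 hs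
    exact mem_quasiperiodicAlgebra_iff.2
      ⟨fun y => ¬ P y, fun u z => by simp only [hP u z], hP'.not, rfl⟩
  union_mem s t hs ht := by
    obtain ⟨P, hP, hP', rfl⟩ := mem_quasiperiodicAlgebra_iff.1 hs
    obtain ⟨Q, hQ, hQ', rfl⟩ := mem_quasiperiodicAlgebra_iff.1 ht
    exact mem_quasiperiodicAlgebra_iff.2
      ⟨fun y => P y ∨ Q y, fun u z => by simp only [hP u z, hQ u z], hP'.or hQ', rfl⟩

/-! ### Weyl's criterion -/

/-- Linearity extends convergence to the span; uniform approximation extends it to all continuous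
functions, because integration against a probability measure is 1-Lipschitz in the sup norm. -/
lemma tendsto_probabilityMeasure_of_span_dense {X γ : Type*} [TopologicalSpace X] [CompactSpace X]
    [MeasurableSpace X] [OpensMeasurableSpace X] {F : Filter γ} {μs : γ → ProbabilityMeasure X}
    {μ : ProbabilityMeasure X} {s : Set C(X, ℂ)}
    (hs : (Submodule.span ℂ s).topologicalClosure = ⊤)
    (h : ∀ f ∈ s, Tendsto (fun i => ∫ x, f x ∂(μs i : Measure X)) F
      (𝓝 (∫ x, f x ∂(μ : Measure X)))) : Tendsto μs F (𝓝 μ) := by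
  have hint : ∀ (f : C(X, ℂ)) (ν : ProbabilityMeasure X), Integrable f (ν : Measure X) :=
    fun f ν => (BoundedContinuousFunction.mkOfCompact f).integrable _
  have hspan : ∀ f ∈ Submodule.span ℂ s, Tendsto (fun i => ∫ x, f x ∂(μs i : Measure X)) F
      (𝓝 (∫ x, f x ∂(μ : Measure X))) := by
    intro f hf
    induction hf using Submodule.span_induction with
    | mem f hf => exact h f hf
    | zero => simpa using tendsto_const_nhds
    | add f g _ _ hf hg =>
      simp only [ContinuousMap.add_apply]
      simp_rw [integral_add (hint f _) (hint g _)]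
      exact hf.add hg
    | smul c f _ hf =>
      simp only [ContinuousMap.smul_apply, integral_smul]
      exact hf.const_smul c
  have hdist : ∀ (f g : C(X, ℂ)) (ν : ProbabilityMeasure X),
      dist (∫ x, f x ∂(ν : Measure X)) (∫ x, g x ∂(ν : Measure X)) ≤ dist f g := by
    intro f g ν
    rw [dist_eq_norm, ← integral_sub (hint f _) (hint g _), dist_eq_norm]
    refine (norm_integral_le_of_norm_le_const (C := ‖f - g‖)
      (Eventually.of_forall fun x => (f - g).norm_coe_le_norm x)).trans ?_
    simp
  rw [ProbabilityMeasure.tendsto_iff_forall_integral_rclike_tendsto ℂ]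
  intro f
  have hf : f.toContinuousMap ∈ closure (Submodule.span ℂ s : Set C(X, ℂ)) := by
    rw [← Submodule.topologicalClosure_coe, hs]; trivial
  rw [Metric.tendsto_nhds]
  intro ε hε
  obtain ⟨g, hg, hfg⟩ := Metric.mem_closure_iff.1 hf (ε / 3) (by positivity)
  filter_upwards [Metric.tendsto_nhds.1 (hspan g hg) (ε / 3) (by positivity)] with i hi
  have h1 := hdist f.toContinuousMap g (μs i)
  have h2 := hdist f.toContinuousMap g μ
  rw [dist_comm] at h2
  calc _ ≤ _ := dist_triangle4 _ (∫ x, g x ∂(μs i : Measure X)) (∫ x, g x ∂(μ : Measure X)) _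
    _ < ε / 3 + ε / 3 + ε / 3 :=
      add_lt_add (add_lt_add (h1.trans_lt hfg) hi) (h2.trans_lt hfg)
    _ = ε := by ring

/-! ### Exponential sums over boxes -/

open scoped Classical in
/-- The discrete parallelepiped as a finite set. -/
noncomputable def boxFinset {n : ℕ} (q : (Fin n → ℤ) × (Fin n → ℕ)) : Finset (Fin n → ℤ) :=
  Fintype.piFinset fun k => Finset.Ico (q.1 k) (q.1 k + q.2 k)

lemma coe_boxFinset {n : ℕ} (q : (Fin n → ℤ) × (Fin n → ℕ)) :
    (boxFinset q : Set (Fin n → ℤ)) = box q.1 q.2 := by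
  ext x; simp [boxFinset, box]

lemma card_boxFinset {n : ℕ} (q : (Fin n → ℤ) × (Fin n → ℕ)) :
    (boxFinset q).card = ∏ k, q.2 k := by
  simp [boxFinset]

lemma norm_sum_exp_Ico_le (θ : ℝ) (a : ℤ) (l : ℕ) :
    ‖∑ m ∈ Finset.Ico a (a + l), Complex.exp (2 * Real.pi * Complex.I * (θ * m))‖ ≤ l := by
  refine (norm_sum_le _ _).trans ?_
  have : ∀ m : ℤ, ‖Complex.exp (2 * Real.pi * Complex.I * (θ * m))‖ = 1 := by
    intro m
    rw [show (2 * Real.pi * Complex.I * (θ * m) : ℂ) = ((2 * Real.pi * (θ * m) : ℝ) : ℂ) *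
      Complex.I by push_cast; ring, Complex.norm_exp_ofReal_mul_I]
  simp [this]

/-- A geometric sum with ratio w ≠ 1 is at most 2 / ‖w - 1‖; the starting point contributes only a
phase of modulus 1, so the bound is uniform in `a`. -/
lemma norm_sum_exp_Ico_le_of_ne {θ : ℝ} (hθ : ∀ m : ℤ, θ ≠ m) : ∃ C : ℝ, ∀ (a : ℤ) (l : ℕ),
    ‖∑ m ∈ Finset.Ico a (a + l), Complex.exp (2 * Real.pi * Complex.I * (θ * m))‖ ≤ C := by
  set w : ℂ := Complex.exp (2 * Real.pi * Complex.I * θ) with hw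
  have hw1 : w ≠ 1 := by
    intro h
    obtain ⟨m, hm⟩ := Complex.exp_eq_one_iff.1 h
    refine hθ m ?_
    have h2 : (2 * Real.pi * Complex.I : ℂ) ≠ 0 := by simp [Real.pi_ne_zero]
    have : (θ : ℂ) = m := by
      apply mul_left_cancel₀ h2
      rw [hm]; ring
    exact_mod_cast this
  have hnorm : ∀ x : ℝ, ‖Complex.exp (2 * Real.pi * Complex.I * x)‖ = 1 := by
    intro x
    rw [show (2 * Real.pi * Complex.I * x : ℂ) = ((2 * Real.pi * x : ℝ) : ℂ) *
      Complex.I by push_cast; ring, Complex.norm_exp_ofReal_mul_I]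
  refine ⟨2 / ‖w - 1‖, fun a l => ?_⟩
  have hsum : ∑ m ∈ Finset.Ico a (a + l), Complex.exp (2 * Real.pi * Complex.I * (θ * m)) =
      Complex.exp (2 * Real.pi * Complex.I * ((θ * a : ℝ) : ℂ)) * ((w ^ l - 1) / (w - 1)) := by
    rw [← geom_sum_eq hw1, Finset.mul_sum]
    symm
    refine Finset.sum_bij (fun i _ => a + (i : ℤ)) ?_ ?_ ?_ ?_
    · intro i hi; simp only [Finset.mem_range] at hi; simp; omega
    · intro i _ j _ h; simpa using h
    · intro m hm
      simp only [Finset.mem_Ico] at hm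
      exact ⟨(m - a).toNat, by simp; omega, by simp; omega⟩
    · intro i _
      rw [hw, ← Complex.exp_nat_mul, ← Complex.exp_add]
      congr 1
      push_cast
      ring
  rw [hsum, norm_mul, hnorm, one_mul, norm_div]
  gcongr
  calc ‖w ^ l - 1‖ ≤ ‖w ^ l‖ + ‖(1 : ℂ)‖ := norm_sub_le _ _
    _ = 2 := by rw [norm_pow, hw, hnorm]; norm_num

lemma sum_boxFinset_exp {n : ℕ} (θ : Fin n → ℝ) (q : (Fin n → ℤ) × (Fin n → ℕ)) :
    ∑ x ∈ boxFinset q, Complex.exp (2 * Real.pi * Complex.I * ((∑ k, θ k * x k : ℝ) : ℂ)) =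
      ∏ k, ∑ m ∈ Finset.Ico (q.1 k) (q.1 k + q.2 k),
        Complex.exp (2 * Real.pi * Complex.I * (θ k * m)) := by
  classical
  rw [Finset.prod_univ_sum]
  refine Finset.sum_congr (by unfold boxFinset; congr!) fun x _ => ?_
  rw [← Complex.exp_sum, ← Finset.mul_sum]
  push_cast
  rfl

/-- The filter along which frequencies are computed. -/
abbrev boxFilter (n : ℕ) : Filter ((Fin n → ℤ) × (Fin n → ℕ)) :=
  (⊤ : Filter (Fin n → ℤ)) ×ˢ (atTop : Filter (Fin n → ℕ))

lemma tendsto_boxFilter_apply {n : ℕ} (j : Fin n) :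
    Tendsto (fun q : (Fin n → ℤ) × (Fin n → ℕ) => q.2 j) (boxFilter n) atTop :=
  have h : Tendsto (fun l : Fin n → ℕ => l j) atTop atTop :=
    tendsto_atTop.2 fun b => (eventually_ge_atTop fun _ => b).mono fun _ h => Pi.le_def.1 h j
  h.comp tendsto_snd

lemma eventually_boxFinset_nonempty (n : ℕ) :
    ∀ᶠ q in boxFilter n, (boxFinset q).Nonempty := by
  have : ∀ᶠ q in boxFilter n, ∀ j, 1 ≤ q.2 j :=
    eventually_all.2 fun j => (tendsto_boxFilter_apply j).eventually_ge_atTop 1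
  filter_upwards [this] with q hq
  rw [← Finset.card_pos, card_boxFinset]
  exact Finset.prod_pos fun j _ => hq j

/-- The average is a product over coordinates. One nonintegral frequency suffices: its factor is at
most C / ℓ_j and the others at most 1, whatever the corner of the box. -/
lemma tendsto_average_exp {n : ℕ} {θ : Fin n → ℝ} {j : Fin n} (hj : ∀ m : ℤ, θ j ≠ m) :
    Tendsto (fun q => ((boxFinset q).card : ℂ)⁻¹ * ∑ x ∈ boxFinset q,
      Complex.exp (2 * Real.pi * Complex.I * ((∑ k, θ k * x k : ℝ) : ℂ))) (boxFilter n) (𝓝 0) := by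
  obtain ⟨C, hC⟩ := norm_sum_exp_Ico_le_of_ne hj
  have hlim : Tendsto (fun q : (Fin n → ℤ) × (Fin n → ℕ) => C * (q.2 j : ℝ)⁻¹) (boxFilter n)
      (𝓝 0) := by
    simpa using ((tendsto_inv_atTop_zero.comp tendsto_natCast_atTop_atTop).comp
      (tendsto_boxFilter_apply j)).const_mul C
  refine squeeze_zero_norm (fun q => ?_) hlim
  rw [sum_boxFinset_exp, card_boxFinset, norm_mul, norm_inv, Complex.norm_natCast, norm_prod]
  push_cast
  rw [← Finset.prod_inv_distrib, ← Finset.prod_mul_distrib,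
    ← Finset.mul_prod_erase _ _ (Finset.mem_univ j)]
  have h1 : ∀ k, (q.2 k : ℝ)⁻¹ * ‖∑ m ∈ Finset.Ico (q.1 k) (q.1 k + q.2 k),
      Complex.exp (2 * Real.pi * Complex.I * (θ k * m))‖ ≤ 1 := by
    intro k
    refine (mul_le_mul_of_nonneg_left (norm_sum_exp_Ico_le _ _ _) (by positivity)).trans ?_
    exact inv_mul_le_one
  calc _ ≤ (q.2 j : ℝ)⁻¹ * C * 1 := by
        refine mul_le_mul (mul_le_mul_of_nonneg_left (hC _ _) (by positivity))
          (Finset.prod_le_one (fun k _ => by positivity) fun k _ => h1 k)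
          (Finset.prod_nonneg fun k _ => by positivity) ?_
        exact mul_nonneg (by positivity) ((norm_nonneg _).trans (hC 0 0))
    _ = C * (q.2 j : ℝ)⁻¹ := by ring

/-! ### Equidistribution on the torus -/

/-- The covering of the torus by real space. -/
def torusMk {ι : Type*} (y : ι → ℝ) : UnitAddTorus ι := fun i => (y i : UnitAddCircle)

lemma continuous_torusMk {ι : Type*} : Continuous (torusMk (ι := ι)) :=
  continuous_pi fun i => (AddCircle.continuous_mk' 1).comp (continuous_apply i)

lemma isOpenMap_torusMk {ι : Type*} [Finite ι] : IsOpenMap (torusMk (ι := ι)) :=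
  IsOpenMap.piMap (fun _ => QuotientAddGroup.isOpenMap_coe) (by simp)

lemma torusMk_eq_iff {ι : Type*} {y w : ι → ℝ} :
    torusMk y = torusMk w ↔ ∃ z : ι → ℤ, w = y + toReal z := by
  have h : ∀ i, ((y i : UnitAddCircle) = w i) ↔ ∃ m : ℤ, w i = y i + m := by
    intro i
    rw [eq_comm, ← sub_eq_zero, ← AddCircle.coe_sub, AddCircle.coe_eq_zero_iff]
    refine exists_congr fun m => ?_
    rw [zsmul_one, eq_comm, sub_eq_iff_eq_add']
  simp only [torusMk, funext_iff, h, Pi.add_apply, toReal]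
  exact Classical.skolem

/-- The uniform distribution on the torus. -/
noncomputable def torusMeasure (ι : Type*) [Fintype ι] : ProbabilityMeasure (UnitAddTorus ι) :=
  ⟨(volume.restrict (cube ι)).map torusMk, by
    constructor
    rw [Measure.map_apply continuous_torusMk.measurable MeasurableSet.univ]
    simp [volume_cube]⟩

/-- The integral factors over coordinates, and a factor with k i ≠ 0 integrates a nontrivial
character over a full period. -/
lemma integral_torusMeasure_mFourier {ι : Type*} [Fintype ι] {k : ι → ℤ} (hk : k ≠ 0) :
    ∫ t, UnitAddTorus.mFourier k t ∂(torusMeasure ι : Measure (UnitAddTorus ι)) = 0 := by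
  obtain ⟨i, hi⟩ := Function.ne_iff.1 hk
  have h0 : (∫ t, UnitAddTorus.mFourier k t ∂(torusMeasure ι : Measure (UnitAddTorus ι))) =
      ∫ y in cube ι, ∏ i, fourier (k i) (y i : UnitAddCircle) :=
    integral_map continuous_torusMk.measurable.aemeasurable
      (UnitAddTorus.mFourier k).continuous.aestronglyMeasurable
  rw [h0, cube, volume_pi, Measure.restrict_pi_pi,
    integral_fintype_prod_eq_prod (fun i (x : ℝ) => fourier (k i) (x : UnitAddCircle))]
  refine Finset.prod_eq_zero (Finset.mem_univ i) ?_
  rw [integral_Ico_eq_integral_Ioc, ← intervalIntegral.integral_of_le zero_le_one]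
  have hc : (2 * Real.pi * Complex.I * k i : ℂ) ≠ 0 := by
    simp [Real.pi_ne_zero, show k i ≠ 0 from hi]
  simp only [fourier_coe_apply, Complex.ofReal_one, div_one]
  rw [integral_exp_mul_complex hc]
  have : Complex.exp (2 * Real.pi * Complex.I * k i) = 1 :=
    Complex.exp_eq_one_iff.2 ⟨k i, by ring⟩
  simp [this]

/-- The uniform distribution on the image of a box. -/
noncomputable def empiricalMeasure {n : ℕ} {ι : Type*} [Fintype ι]
    (φ : (Fin n → ℤ) → UnitAddTorus ι) (q : (Fin n → ℤ) × (Fin n → ℕ)) :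
    ProbabilityMeasure (UnitAddTorus ι) :=
  open scoped Classical in
  if h : (boxFinset q).Nonempty then
    ⟨((boxFinset q).card : ENNReal)⁻¹ • ∑ x ∈ boxFinset q, Measure.dirac (φ x), by
      constructor
      simp only [Measure.smul_apply, Measure.finsetSum_apply, measure_univ, Finset.sum_const,
        nsmul_eq_mul, mul_one, smul_eq_mul]
      exact ENNReal.inv_mul_cancel (by simpa using h.ne_empty) (by simp)⟩
  -- An arbitrary value: boxes are eventually nonempty along `boxFilter`.
  else ⟨Measure.dirac 0, inferInstance⟩

lemma coe_empiricalMeasure {n : ℕ} {ι : Type*} [Fintype ι]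
    (φ : (Fin n → ℤ) → UnitAddTorus ι) {q : (Fin n → ℤ) × (Fin n → ℕ)}
    (h : (boxFinset q).Nonempty) :
    (empiricalMeasure φ q : Measure (UnitAddTorus ι)) =
      ((boxFinset q).card : ENNReal)⁻¹ • ∑ x ∈ boxFinset q, Measure.dirac (φ x) := by
  have : empiricalMeasure φ q = ⟨_, _⟩ := dif_pos h
  rw [this]
  rfl

lemma integral_empiricalMeasure {n : ℕ} {ι : Type*} [Fintype ι]
    (φ : (Fin n → ℤ) → UnitAddTorus ι) {q : (Fin n → ℤ) × (Fin n → ℕ)}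
    (h : (boxFinset q).Nonempty) (f : C(UnitAddTorus ι, ℂ)) :
    ∫ t, f t ∂(empiricalMeasure φ q : Measure (UnitAddTorus ι)) =
      ((boxFinset q).card : ℂ)⁻¹ * ∑ x ∈ boxFinset q, f (φ x) := by
  rw [coe_empiricalMeasure φ h, integral_smul_measure, integral_finsetSum_measure]
  · simp
  · exact fun x _ => (BoundedContinuousFunction.mkOfCompact f).integrable _

lemma toReal_empiricalMeasure {n : ℕ} {ι : Type*} [Fintype ι]
    (φ : (Fin n → ℤ) → UnitAddTorus ι) {q : (Fin n → ℤ) × (Fin n → ℕ)}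
    (h : (boxFinset q).Nonempty) (S : Set (UnitAddTorus ι)) :
    ((empiricalMeasure φ q : Measure (UnitAddTorus ι)) S).toReal =
      fraction {x | φ x ∈ S} q.1 q.2 := by
  classical
  rw [coe_empiricalMeasure φ h, fraction, ← coe_boxFinset]
  have : {x | φ x ∈ S} ∩ (boxFinset q : Set (Fin n → ℤ)) =
      ((boxFinset q).filter fun x => φ x ∈ S : Finset _) := by
    ext x; simp [and_comm]
  rw [this, Set.ncard_coe_finset, Set.ncard_coe_finset]
  simp only [Measure.smul_apply, Measure.finsetSum_apply, Measure.dirac_apply, smul_eq_mul,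
    ENNReal.toReal_mul, ENNReal.toReal_inv, ENNReal.toReal_natCast, Set.indicator_apply,
    Finset.sum_boole, Pi.one_apply]
  rw [div_eq_inv_mul]

/-- If kΛ were an integer vector m, then k and -m would be the coefficients of a rational relation
between the rows of Λ and of the identity. -/
lemma Nonresonant.exists_ne_int {n : ℕ} {ι : Type*} [Fintype ι] {Λ : Matrix ι (Fin n) ℝ}
    (hΛ : Nonresonant Λ) {k : ι → ℤ} (hk : k ≠ 0) :
    ∃ j, ∀ m : ℤ, Matrix.vecMul (toReal k) Λ j ≠ m := by
  by_contra! h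
  choose m hm using h
  refine hk ?_
  have := Fintype.linearIndependent_iff.1 hΛ
    (Sum.elim (fun j => -(m j : ℚ)) (fun i => (k i : ℚ))) ?_
  · ext i
    simpa using this (Sum.inr i)
  · ext j
    have := hm j
    simp only [Matrix.vecMul, dotProduct, toReal] at this
    simp [Matrix.row, Matrix.one_apply, Rat.smul_def, this]

/-- Weyl equidistribution: the character k evaluated at Λx is the exponential of frequency kΛ at x,
and for k ≠ 0 some coordinate of kΛ is not an integer. -/
lemma Nonresonant.tendsto_empiricalMeasure {n : ℕ} {ι : Type*} [Fintype ι]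
    {Λ : Matrix ι (Fin n) ℝ} (hΛ : Nonresonant Λ) :
    Tendsto (empiricalMeasure fun x => torusMk (Λ.mulVec (toReal x))) (boxFilter n)
      (𝓝 (torusMeasure ι)) := by
  refine tendsto_probabilityMeasure_of_span_dense UnitAddTorus.span_mFourier_closure_eq_top ?_
  rintro _ ⟨k, rfl⟩
  by_cases hk : k = 0
  · subst hk
    simp [UnitAddTorus.mFourier_zero]
  obtain ⟨j, hj⟩ := hΛ.exists_ne_int hk
  rw [integral_torusMeasure_mFourier hk]
  refine (tendsto_average_exp hj).congr' ?_
  filter_upwards [eventually_boxFinset_nonempty n] with q hq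
  rw [integral_empiricalMeasure _ hq]
  congr 1
  refine Finset.sum_congr rfl fun x _ => ?_
  simp only [UnitAddTorus.mFourier, ContinuousMap.coe_mk, torusMk, fourier_coe_apply,
    Complex.ofReal_one, div_one]
  rw [← Complex.exp_sum]
  congr 1
  have : ∑ j, Matrix.vecMul (toReal k) Λ j * x j = ∑ i, k i * Λ.mulVec (toReal x) i :=
    (Matrix.dotProduct_mulVec (toReal k) Λ (toReal x)).symm
  rw [this]
  push_cast
  rw [Finset.mul_sum]
  exact Finset.sum_congr rfl fun i _ => by ring

/-- Frequencies of quasiperiodic sets with nonresonant matrices. -/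
theorem Nonresonant.hasFrequency {n : ℕ} {ι : Type*} [Fintype ι] {Λ : Matrix ι (Fin n) ℝ}
    (hΛ : Nonresonant Λ) {P : (ι → ℝ) → Prop} (hP : Periodic P) (hP' : AELocConst P) :
    HasFrequency {x | P (Λ.mulVec (toReal x))} (volume.real {g | P g ∧ floorPi g = 0}) := by
  set S : Set (UnitAddTorus ι) := torusMk '' {y | P y} with hS
  have hmem : ∀ y, torusMk y ∈ S ↔ P y := by
    intro y
    refine ⟨?_, fun h => ⟨y, h, rfl⟩⟩
    rintro ⟨w, hw, h⟩
    obtain ⟨z, rfl⟩ := torusMk_eq_iff.1 h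
    rw [hP]; exact hw
  have hpre : torusMk ⁻¹' S = {y | P y} := Set.ext hmem
  -- The covering is open and continuous, so it pulls the frontier of `S` back to that of `P`, which
  -- is null; the portmanteau theorem then applies to `S`.
  have hfr : (torusMeasure ι : Measure (UnitAddTorus ι)) (frontier S) = 0 := by
    change (volume.restrict (cube ι)).map torusMk (frontier S) = 0
    rw [Measure.map_apply continuous_torusMk.measurable isClosed_frontier.measurableSet,
      isOpenMap_torusMk.preimage_frontier_eq_frontier_preimage continuous_torusMk, hpre]
    exact Measure.absolutelyContinuous_of_le Measure.restrict_le_self hP'.volume_frontier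
  have hval : (torusMeasure ι : Measure (UnitAddTorus ι)) S = volume {g | P g ∧ floorPi g = 0} := by
    change (volume.restrict (cube ι)).map torusMk S = _
    rw [Measure.map_apply₀ continuous_torusMk.measurable.aemeasurable
      (nullMeasurableSet_of_null_frontier hfr), hpre, Measure.restrict_apply' measurableSet_cube]
    congr 1
    ext g
    simp [mem_cube_iff]
  have := ProbabilityMeasure.tendsto_measure_of_null_frontier_of_tendsto'
    hΛ.tendsto_empiricalMeasure hfr
  have h2 := (ENNReal.tendsto_toReal (measure_ne_top _ S)).comp this
  rw [hval] at h2
  refine h2.congr' ?_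
  filter_upwards [eventually_boxFinset_nonempty n] with q hq
  rw [Function.comp_apply, toReal_empiricalMeasure _ hq]
  simp only [hmem]

lemma HasFrequency.unique {n : ℕ} {A : Set (Fin n → ℤ)} {p p' : ℝ} (h : HasFrequency A p)
    (h' : HasFrequency A p') : p = p' :=
  tendsto_nhds_unique h h'

/-! ### Skew products -/

/-- Jordan measurable sets need not be Borel, so Tonelli is needed for null measurable sets; it
passes through a measurable hull with almost all slices almost equal. -/
lemma measure_prod_apply₀ {X Y : Type*} [MeasurableSpace X] [MeasurableSpace Y] {μ : Measure X}
    {ν : Measure Y} [SFinite ν] {s : Set (X × Y)} (hs : NullMeasurableSet s (μ.prod ν)) :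
    μ.prod ν s = ∫⁻ x, ν (Prod.mk x ⁻¹' s) ∂μ := by
  have h := hs.toMeasurable_ae_eq
  rw [← measure_congr h, Measure.prod_apply (measurableSet_toMeasurable _ _)]
  refine lintegral_congr_ae ?_
  filter_upwards [Measure.ae_ae_of_ae_prod h] with x hx
  exact measure_congr hx

lemma AELocConst.of_ae_ae {X Z : Type*} [TopologicalSpace X] [MeasureSpace X] [BorelSpace X]
    {n : ℕ} {f : X × (Fin n → ℝ) → Z}
    (hf : ∀ᵐ p : X, ∀ᵐ q : Fin n → ℝ, ∀ᶠ y in 𝓝 (p, q), f y = f (p, q)) : AELocConst f := by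
  have : MeasurableSet {x | ∀ᶠ y in 𝓝 x, f y = f x} := (isOpen_setOf_eventually_eq f).measurableSet
  exact (Measure.ae_prod_iff_ae_ae this).2 hf

section Skew

variable {X : Type*} [TopologicalSpace X] [MeasureSpace X] [BorelSpace X]
  {n : ℕ}

/-- Checked fibrewise: for almost every `p` the shift `c` is continuous at `p` and `g` is constant
near it, while translation by `c p` preserves null sets in the fibre. -/
lemma AELocConst.skew {Z W : Type*} {c : X → Fin n → ℝ} (hc : ∀ᵐ p, ContinuousAt c p) {g : X → W}
    (hg : AELocConst g) {h : W → (Fin n → ℝ) → Z} (hh : ∀ p, AELocConst (h (g p))) :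
    AELocConst (fun y : X × (Fin n → ℝ) => h (g y.1) (y.2 - c y.1)) := by
  refine AELocConst.of_ae_ae ?_
  filter_upwards [hc, hg] with p hp hp'
  filter_upwards [(measurePreserving_sub_right volume (c p)).quasiMeasurePreserving.ae (hh p)]
    with q hq
  have h1 : Tendsto (fun y : X × (Fin n → ℝ) => y.2 - c y.1) (𝓝 (p, q)) (𝓝 (q - c p)) :=
    (continuous_snd.continuousAt).sub
      (ContinuousAt.comp (f := Prod.fst) hp continuous_fst.continuousAt)
  have h2 : ∀ᶠ y : X × (Fin n → ℝ) in 𝓝 (p, q), g y.1 = g p :=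
    (continuous_fst.tendsto (p, q)).eventually hp'
  filter_upwards [h2, h1.eventually hq] with y hy hy'
  rw [hy, hy']

lemma AELocConst.skew_and_floorPi {c : X → Fin n → ℝ} (hc : ∀ᵐ p, ContinuousAt c p)
    {P : X → Prop} (hP : AELocConst P) {D : (Fin n → ℝ) → Prop} (hD : AELocConst D) :
    AELocConst fun y : X × (Fin n → ℝ) => P y.1 ∧ D (y.2 - c y.1) ∧ floorPi y.2 = 0 := by
  have hfst : AELocConst fun y : X × (Fin n → ℝ) => P y.1 := by
    have := AELocConst.skew hc hP (h := fun w _ => w) fun p => AELocConst.const _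
    exact this
  have hsnd : AELocConst fun y : X × (Fin n → ℝ) => floorPi y.2 := by
    have := AELocConst.skew (X := X) (c := fun _ => (0 : Fin n → ℝ))
      (ae_of_all _ fun _ => continuousAt_const) (AELocConst.const ())
      (h := fun _ q => floorPi q) fun p => aeLocConst_floorPi
    simpa using this
  have hskew : AELocConst fun y : X × (Fin n → ℝ) => D (y.2 - c y.1) :=
    AELocConst.skew hc (AELocConst.const ()) (h := fun _ q => D q) fun p => hD
  exact hfst.and (hskew.and (hsnd.eq_const 0))

/-- This is the independence behind the Markov property. In the fibre over `p`, periodicity of `D`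
allows the unit cube to be replaced by the cell of `f` shifted by `c p`; translating back, the slice
has a volume free of `p`. -/
lemma volume_skew [SecondCountableTopology X] {c : X → Fin n → ℝ} (hc : ∀ᵐ p, ContinuousAt c p)
    {P : X → Prop} (hP : AELocConst P) {f : (Fin n → ℝ) → (Fin n → ℤ)} (hf : Equivariant f)
    (hf' : AELocConst f) {D : (Fin n → ℝ) → Prop} (hD : Periodic D) (hD' : AELocConst D) :
    volume {y : X × (Fin n → ℝ) | P y.1 ∧ D (y.2 - c y.1) ∧ floorPi y.2 = 0} =
      volume {p | P p} * volume {u | D u ∧ f u = 0} := by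
  have hslice : ∀ p, volume {q | D (q - c p) ∧ floorPi q = 0} = volume {u | D u ∧ f u = 0} := by
    intro p
    have h1 : Periodic fun q => D (q - c p) := fun u z => by
      simp only [add_sub_right_comm, hD (u - c p) z]
    have h2 : Equivariant fun q => f (q - c p) := fun u z => by
      simp only [add_sub_right_comm, hf (u - c p) z]
    have h3 := measurePreserving_sub_right (volume : Measure (Fin n → ℝ)) (c p)
    have h4 : Continuous fun q => q - c p := by fun_prop
    rw [volume_cell_eq equivariant_floorPi h2 aeLocConst_floorPi
      (hf'.comp_quasiMeasurePreserving h4 h3.quasiMeasurePreserving) h1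
      (hD'.comp_quasiMeasurePreserving h4 h3.quasiMeasurePreserving)]
    exact h3.measure_preimage (hD'.and (hf'.eq_const 0)).nullMeasurableSet
  rw [Measure.volume_eq_prod, measure_prod_apply₀
    (AELocConst.skew_and_floorPi hc hP hD').nullMeasurableSet,
    mul_comm, ← lintegral_indicator_const₀ hP.nullMeasurableSet]
  refine lintegral_congr fun p => ?_
  by_cases hp : P p
  · simp [hp, hslice]
  · simp [hp]

end Skew

/-! ### Blocks of coordinates -/

/-- All blocks but the last one. -/
def initBlocks {N n : ℕ} {Z : Type*} (y : Fin (N + 1) × Fin n → Z) : Fin N × Fin n → Z :=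
  fun r => y (r.1.castSucc, r.2)

/-- The last block. -/
def lastBlock {N n : ℕ} {Z : Type*} (y : Fin (N + 1) × Fin n → Z) : Fin n → Z :=
  fun j => y (Fin.last N, j)

lemma initBlocks_add_toReal {N n : ℕ} (y : Fin (N + 1) × Fin n → ℝ) (z : Fin (N + 1) × Fin n → ℤ) :
    initBlocks (y + toReal z) = initBlocks y + toReal (initBlocks z) := rfl

lemma lastBlock_add_toReal {N n : ℕ} (y : Fin (N + 1) × Fin n → ℝ) (z : Fin (N + 1) × Fin n → ℤ) :
    lastBlock (y + toReal z) = lastBlock y + toReal (lastBlock z) := rfl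

lemma floorPi_eq_zero_iff_blocks {N n : ℕ} (y : Fin (N + 1) × Fin n → ℝ) :
    floorPi y = 0 ↔ floorPi (initBlocks y) = 0 ∧ floorPi (lastBlock y) = 0 := by
  simp only [funext_iff, Prod.forall, Fin.forall_fin_succ', floorPi, initBlocks, lastBlock,
    Pi.zero_apply]

/-- The splitting of the indices of blocks. -/
def blockEquiv (N n : ℕ) : Fin (N + 1) × Fin n ≃ (Fin N × Fin n) ⊕ Fin n :=
  ((finSumFinEquiv (m := N) (n := 1)).symm.prodCongr (Equiv.refl _)).trans <|
    (Equiv.sumProdDistrib _ _ _).trans <| (Equiv.refl _).sumCongr (Equiv.uniqueProd _ _)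

lemma continuous_splitBlocks (N n : ℕ) : Continuous
    (fun y : Fin (N + 1) × Fin n → ℝ => (initBlocks y, lastBlock y)) := by
  unfold initBlocks lastBlock
  fun_prop

lemma measurePreserving_splitBlocks (N n : ℕ) : MeasurePreserving
    (fun y : Fin (N + 1) × Fin n → ℝ => (initBlocks y, lastBlock y)) volume volume := by
  have h1 := volume_measurePreserving_piCongrLeft (fun _ : (Fin N × Fin n) ⊕ Fin n => ℝ)
    (blockEquiv N n)
  have h2 := volume_measurePreserving_sumPiEquivProdPi (fun _ : (Fin N × Fin n) ⊕ Fin n => ℝ)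
  convert h2.comp h1 using 1
  funext y
  refine Prod.ext (funext fun r => ?_) (funext fun j => ?_)
  · have := Equiv.piCongrLeft_apply_apply (fun _ : (Fin N × Fin n) ⊕ Fin n => ℝ) (blockEquiv N n) y
      (r.1.castSucc, r.2)
    rw [show blockEquiv N n (r.1.castSucc, r.2) = Sum.inl r from ?_] at this
    · exact this.symm
    · rw [← Equiv.eq_symm_apply]; rfl
  · have := Equiv.piCongrLeft_apply_apply (fun _ : (Fin N × Fin n) ⊕ Fin n => ℝ) (blockEquiv N n) y
      (Fin.last N, j)
    rw [show blockEquiv N n (Fin.last N, j) = Sum.inr j from ?_] at this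
    · exact this.symm
    · rw [← Equiv.eq_symm_apply]; rfl

lemma AELocConst.comp_splitBlocks {N n : ℕ} {Z : Type*}
    {f : (Fin N × Fin n → ℝ) × (Fin n → ℝ) → Z} (hf : AELocConst f) :
    AELocConst (fun y : Fin (N + 1) × Fin n → ℝ => f (initBlocks y, lastBlock y)) :=
  hf.comp_quasiMeasurePreserving (continuous_splitBlocks N n)
    (measurePreserving_splitBlocks N n).quasiMeasurePreserving

lemma AELocConst.comp_initBlocks {N n : ℕ} {Z : Type*} {f : (Fin N × Fin n → ℝ) → Z}
    (hf : AELocConst f) : AELocConst (fun y : Fin (N + 1) × Fin n → ℝ => f (initBlocks y)) :=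
  (hf.comp_quasiMeasurePreserving continuous_fst
    Measure.quasiMeasurePreserving_fst).comp_splitBlocks

/-! ### Quantizers -/

section Quantizer

variable {n : ℕ} {R : (Fin n → ℝ) → (Fin n → ℤ)} {L : Matrix (Fin n) (Fin n) ℝ}

lemma IsQuantizer.equivariant (hR : IsQuantizer R) : Equivariant R := hR.map_add

lemma IsQuantizer.aeLocConst (hR : IsQuantizer R) : AELocConst R :=
  hR.equivariant.aeLocConst hR.jordan.2

/-- The quantization error. -/
def frac (R : (Fin n → ℝ) → (Fin n → ℤ)) (u : Fin n → ℝ) : Fin n → ℝ := u - toReal (R u)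

lemma IsQuantizer.frac_mem_cell (hR : IsQuantizer R) (u : Fin n → ℝ) : frac R u ∈ R ⁻¹' {0} := by
  simp [frac, sub_eq_add_neg, ← toReal_neg, hR.map_add]

lemma IsQuantizer.periodic_frac (hR : IsQuantizer R) : Periodic (frac R) :=
  hR.equivariant.periodic_frac

open scoped Pointwise in
lemma IsQuantizer.comp_add_const (hR : IsQuantizer R) (c : Fin n → ℝ) :
    IsQuantizer fun u => R (u + c) where
  map_add u z := by rw [add_right_comm, hR.map_add]
  jordan := by
    have h : (fun u => R (u + c)) ⁻¹' {0} = Homeomorph.addRight c ⁻¹' (R ⁻¹' {0}) := rfl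
    rw [h]
    constructor
    · refine ((hR.jordan.1).add (Bornology.isBounded_singleton (x := -c))).subset fun u hu => ?_
      exact Set.mem_add.2 ⟨u + c, hu, -c, rfl, by simp⟩
    · rw [← Homeomorph.preimage_frontier]
      exact (measurePreserving_add_right volume c).quasiMeasurePreserving.preimage_null
        hR.jordan.2

lemma IsQuantizer.compQuantizer (hR : IsQuantizer R) (L : Matrix (Fin n) (Fin n) ℝ) :
    IsQuantizer (compQuantizer R L) :=
  hR.comp_add_const _

lemma IsQuantizer.volume_cell (hR : IsQuantizer R) : volume {u | R u = 0} = 1 := by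
  have := volume_cell_eq hR.equivariant equivariant_floorPi hR.aeLocConst aeLocConst_floorPi
    (Q := fun _ => True) (fun _ _ => rfl) (AELocConst.const _)
  simp only [true_and] at this
  rw [this, ← volume_cube (ι := Fin n)]
  congr 1
  ext u
  exact mem_cube_iff.symm

/-- Each vector L(z - u) splits uniquely as a + v with v in the cell of `R`, and a is its quantized
value. -/
lemma mem_latticeStep_iff (hR : IsQuantizer R) (hL : L.det ≠ 0) {A : Set (Fin n → ℤ)}
    {u : Fin n → ℝ} {z : Fin n → ℤ} :
    z ∈ latticeStep R L A u ↔ R (L.mulVec (toReal z - u)) ∈ A := by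
  have hu : IsUnit L.det := hL.isUnit
  constructor
  · rintro ⟨a, ha, v, hv, h⟩
    rw [h, add_sub_cancel_left, Matrix.mulVec_mulVec, Matrix.mul_nonsing_inv _ hu,
      Matrix.one_mulVec, add_comm, hR.map_add, show R v = 0 from hv, zero_add]
    exact ha
  · intro h
    refine ⟨_, h, _, hR.frac_mem_cell (L.mulVec (toReal z - u)), ?_⟩
    simp only [frac]
    rw [add_sub_cancel, Matrix.mulVec_mulVec, Matrix.nonsing_inv_mul _ hu, Matrix.one_mulVec,
      add_sub_cancel]

open scoped Classical in
lemma finite_setOf_toReal_mem {ι : Type*} [Fintype ι] {s : Set (ι → ℝ)}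
    (hs : Bornology.IsBounded s) : {z : ι → ℤ | toReal z ∈ s}.Finite := by
  obtain ⟨C, hC⟩ := hs.exists_norm_le
  refine (Set.finite_Icc (fun _ => -⌈C⌉) (fun _ => ⌈C⌉)).subset fun z hz => ?_
  have h : ∀ i, |(z i : ℝ)| ≤ C := fun i => (norm_le_pi_norm (toReal z) i).trans (hC _ hz)
  have h' : ∀ i, |z i| ≤ ⌈C⌉ := fun i => by
    have := (h i).trans (Int.le_ceil C)
    exact_mod_cast this
  exact ⟨fun i => (abs_le.1 (h' i)).1, fun i => (abs_le.1 (h' i)).2⟩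

open scoped Pointwise in
lemma exists_finite_latticeStep_subset (hR : IsQuantizer R) {A : Set (Fin n → ℤ)}
    (hA : A.Finite) {s : Set (Fin n → ℝ)} (hs : Bornology.IsBounded s) :
    ∃ F : Set (Fin n → ℤ), F.Finite ∧ ∀ u ∈ s, latticeStep R L A u ⊆ F := by
  have hb : Bornology.IsBounded (s + (fun w => L⁻¹.mulVec w) '' (toReal '' A + R ⁻¹' {0})) := by
    refine hs.add ?_
    exact (LinearMap.toContinuousLinearMap L⁻¹.mulVecLin).lipschitz.isBounded_image
      ((hA.image _).isBounded.add hR.jordan.1)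
  refine ⟨_, finite_setOf_toReal_mem hb, ?_⟩
  rintro u hu z ⟨a, ha, v, hv, h⟩
  rw [Set.mem_ofPred_eq, h]
  exact Set.add_mem_add hu ⟨_, Set.add_mem_add ⟨a, ha, rfl⟩ hv, rfl⟩

lemma finite_latticeStep (hR : IsQuantizer R) {A : Set (Fin n → ℤ)} (hA : A.Finite)
    (u : Fin n → ℝ) : (latticeStep R L A u).Finite := by
  obtain ⟨F, hF, h⟩ := exists_finite_latticeStep_subset (L := L) hR hA
    (Bornology.isBounded_singleton (x := u))
  exact hF.subset (h u rfl)

/-- Each membership test is locally constant almost everywhere, but infinitely many tests need not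
share a neighbourhood. Boundedness of the cell of `Q` leaves only the finitely many candidates in
`F`. -/
lemma aeLocConst_latticeStep (hR : IsQuantizer R) (hL : L.det ≠ 0) {A : Set (Fin n → ℤ)}
    (hA : A.Finite) {Q : (Fin n → ℝ) → (Fin n → ℤ)} (hQ : IsQuantizer Q) :
    AELocConst (fun u => latticeStep R L A (frac Q u)) := by
  obtain ⟨F, hF, hsub⟩ := exists_finite_latticeStep_subset (L := L) hR hA hQ.jordan.1
  have h1 : ∀ᵐ u : Fin n → ℝ, ∀ z : Fin n → ℤ, ∀ᶠ v in 𝓝 u,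
      R (L.mulVec (toReal z - v)) = R (L.mulVec (toReal z - u)) := by
    refine ae_all_iff.2 fun z => ?_
    have hq : Measure.QuasiMeasurePreserving (fun v : Fin n → ℝ => L.mulVec v) volume volume := by
      have : LinearMap.det L.mulVecLin ≠ 0 := by
        rwa [← Matrix.toLin'_apply', LinearMap.det_toLin']
      exact Measure.LinearMap.quasiMeasurePreserving volume L.mulVecLin this
    refine hR.aeLocConst.comp_quasiMeasurePreserving (g := fun v => L.mulVec (toReal z - v)) ?_ ?_
    · exact (Continuous.matrix_mulVec continuous_const (continuous_const.sub continuous_id))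
    · exact hq.comp (Measure.measurePreserving_sub_left volume (toReal z)).quasiMeasurePreserving
  filter_upwards [h1, hQ.aeLocConst] with u hu hu'
  -- Near `u` the error of `Q` at v is v - Q u, so testing z against it is testing z + Q u against
  -- v.
  filter_upwards [hu', (eventually_all_finite hF).2 fun z _ => hu (z + Q u)] with v hv hv'
  have key : ∀ z ∈ F, (z ∈ latticeStep R L A (frac Q v) ↔ z ∈ latticeStep R L A (frac Q u)) := by
    intro z hz
    have h2 : ∀ w, Q w = Q u → toReal z - frac Q w = toReal (z + Q u) - w := by
      intro w hw
      rw [frac, hw, toReal_add]; abel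
    rw [mem_latticeStep_iff hR hL, mem_latticeStep_iff hR hL, h2 v hv, h2 u rfl, hv' z hz]
  ext z
  exact ⟨fun h => (key z (hsub _ (hQ.frac_mem_cell v) h)).1 h,
    fun h => (key z (hsub _ (hQ.frac_mem_cell u) h)).2 h⟩

/-- On the cell the error is the point itself. Using the error turns the event into a periodic one,
as `volume_skew` requires. -/
lemma kernel_eq (A B : Finset (Fin n → ℤ)) : kernel R L A B =
    volume.real {u | latticeStep R L A (frac (compQuantizer R L) u) = B ∧
      compQuantizer R L u = 0} := by
  unfold kernel
  congr 1
  ext u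
  simp only [Set.mem_ofPred_eq, Set.mem_preimage, Set.mem_singleton_iff]
  rw [and_comm]
  refine and_congr_left fun h => ?_
  rw [frac, h, toReal_zero, sub_zero]

lemma hasSum_kernel (hR : IsQuantizer R) (hL : L.det ≠ 0) (A : Finset (Fin n → ℤ)) :
    HasSum (fun B => kernel R L A B) 1 := by
  classical
  have hQ := hR.compQuantizer L
  -- Every step is finite, so it can be recoded with values in the countable type of finsets; its
  -- level sets then partition a cell of volume 1.
  set f : (Fin n → ℝ) → Finset (Fin n → ℤ) := fun u =>
    Function.invFun (fun B : Finset (Fin n → ℤ) => (B : Set (Fin n → ℤ)))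
      (latticeStep R L A (frac (compQuantizer R L) u)) with hf
  have hf' : AELocConst f := (aeLocConst_latticeStep hR hL A.finite_toSet hQ).comp _
  have hiff : ∀ u B, f u = B ↔ latticeStep R L A (frac (compQuantizer R L) u) = B := by
    intro u B
    obtain ⟨B', hB'⟩ := (finite_latticeStep (L := L) hR A.finite_toSet
      (frac (compQuantizer R L) u)).exists_finset_coe
    rw [hf]
    simp only [← hB', Function.leftInverse_invFun Finset.coe_injective B', Finset.coe_inj]
  have h := hf'.volume_eq_tsum (hQ.aeLocConst.eq_const 0)
  rw [hQ.volume_cell] at h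
  have h2 := ENNReal.hasSum_toReal (f := fun B => volume {u | compQuantizer R L u = 0 ∧ f u = B})
    (by rw [← h]; simp)
  rw [← ENNReal.tsum_toReal_eq, ← h] at h2
  · rw [ENNReal.toReal_one] at h2
    convert h2 using 2 with B
    rw [kernel_eq, Measure.real]
    congr 2
    ext u
    simp only [Set.mem_ofPred_eq, hiff, and_comm]
  · intro B
    exact ne_top_of_le_ne_top ENNReal.one_ne_top
      ((measure_mono fun u hu => hu.1).trans hQ.volume_cell.le)

end Quantizer

/-! ### The backward dynamics in torus coordinates -/

section Lift

variable {n : ℕ} {R Q : (Fin n → ℝ) → (Fin n → ℤ)} {L : Matrix (Fin n) (Fin n) ℝ}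

/-- The deviation of `Q`-quantized iterates of `L⁻¹` from the linear ones, as a function of
the stacked vectors `L⁻¹ x, …, L^(-N) x`. -/
noncomputable def deviation (Q : (Fin n → ℝ) → (Fin n → ℤ)) (L : Matrix (Fin n) (Fin n) ℝ) :
    ∀ N, (Fin N × Fin n → ℝ) → (Fin n → ℝ)
  | 0, _ => 0
  | N + 1, y => lastBlock y - toReal (Q (lastBlock y - L⁻¹.mulVec (deviation Q L N (initBlocks y))))

/-- The sets `Σ_N` as functions of the stacked vectors `L⁻¹ x, …, L^(-N) x`. -/
def basinLift (R Q : (Fin n → ℝ) → (Fin n → ℤ)) (L : Matrix (Fin n) (Fin n) ℝ) :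
    ∀ N, (Fin N × Fin n → ℝ) → Set (Fin n → ℤ)
  | 0, _ => {0}
  | N + 1, y => latticeStep R L (basinLift R Q L N (initBlocks y))
      (frac Q (lastBlock y - L⁻¹.mulVec (deviation Q L N (initBlocks y))))

lemma periodic_deviation (hQ : IsQuantizer Q) (N : ℕ) : Periodic (deviation Q L N) := by
  induction N with
  | zero => exact fun _ _ => rfl
  | succ N ih =>
    intro y z
    simp only [deviation, initBlocks_add_toReal, lastBlock_add_toReal, ih (initBlocks y),
      add_sub_right_comm, hQ.map_add, toReal_add]
    abel

lemma periodic_basinLift (hQ : IsQuantizer Q) (N : ℕ) : Periodic (basinLift R Q L N) := by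
  induction N with
  | zero => exact fun _ _ => rfl
  | succ N ih =>
    intro y z
    simp only [basinLift, initBlocks_add_toReal, lastBlock_add_toReal, ih (initBlocks y),
      periodic_deviation hQ N (initBlocks y), add_sub_right_comm, hQ.periodic_frac _ _]

lemma finite_basinLift (hR : IsQuantizer R) (N : ℕ) (y : Fin N × Fin n → ℝ) :
    (basinLift R Q L N y).Finite := by
  induction N with
  | zero => exact Set.finite_singleton _
  | succ N ih => exact finite_latticeStep hR (ih _) _

lemma ae_continuousAt_mulVec {X : Type*} [TopologicalSpace X] [MeasureSpace X]
    {c : X → Fin n → ℝ} (M : Matrix (Fin n) (Fin n) ℝ) (hc : ∀ᵐ y, ContinuousAt c y) :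
    ∀ᵐ y, ContinuousAt (fun y => M.mulVec (c y)) y := by
  filter_upwards [hc] with y hy
  exact (Continuous.matrix_mulVec continuous_const continuous_id).continuousAt.comp hy

/-- The deviation is the last block, which is continuous, minus a lattice vector that is locally
constant almost everywhere. -/
lemma ae_continuousAt_deviation (hQ : IsQuantizer Q) (N : ℕ) :
    ∀ᵐ y, ContinuousAt (deviation Q L N) y := by
  induction N with
  | zero => exact ae_of_all _ fun _ => continuousAt_const
  | succ N ih =>
    have hc := ae_continuousAt_mulVec L⁻¹ ih
    have h : AELocConst fun y : Fin (N + 1) × Fin n → ℝ =>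
        Q (lastBlock y - L⁻¹.mulVec (deviation Q L N (initBlocks y))) :=
      (AELocConst.skew hc (AELocConst.const ()) (h := fun _ q => Q q)
        fun _ => hQ.aeLocConst).comp_splitBlocks
    filter_upwards [h] with y hy
    have h2 : Continuous fun y : Fin (N + 1) × Fin n → ℝ => lastBlock y :=
      continuous_snd.comp (continuous_splitBlocks N n)
    refine h2.continuousAt.sub ?_
    exact (continuousAt_const (y := toReal (Q (lastBlock y -
      L⁻¹.mulVec (deviation Q L N (initBlocks y)))))).congr (hy.mono fun w hw => by simp only [hw])

lemma aeLocConst_basinLift (hR : IsQuantizer R) (hQ : IsQuantizer Q) (hL : L.det ≠ 0) (N : ℕ) :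
    AELocConst (basinLift R Q L N) := by
  induction N with
  | zero => exact AELocConst.const _
  | succ N ih =>
    exact (AELocConst.skew (ae_continuousAt_mulVec L⁻¹ (ae_continuousAt_deviation hQ N)) ih
      (h := fun A u => latticeStep R L A (frac Q u))
      fun p => aeLocConst_latticeStep hR hL (finite_basinLift hR N p) hQ).comp_splitBlocks

/-! ### Reading iterates and preimages off the stacked vectors -/

lemma initBlocks_backwardMatrix_mulVec (N : ℕ) (v : Fin n → ℝ) :
    initBlocks ((backwardMatrix L (N + 1)).mulVec v) = (backwardMatrix L N).mulVec v := rfl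

lemma lastBlock_backwardMatrix_mulVec (hL : L.det ≠ 0) (N : ℕ) (v : Fin n → ℝ) :
    lastBlock ((backwardMatrix L (N + 1)).mulVec v) =
      L⁻¹.mulVec ((L ^ (-(N : ℤ))).mulVec v) := by
  rw [Matrix.mulVec_mulVec]
  have : L⁻¹ * L ^ (-(N : ℤ)) = L ^ (-((N : ℤ) + 1)) := by
    rw [neg_add, add_comm, Matrix.zpow_add hL.isUnit, Matrix.zpow_neg_one]
  rw [this]
  rfl

lemma toReal_iterate_transition (hL : L.det ≠ 0) (N : ℕ) (x : Fin n → ℤ) :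
    toReal ((transition Q L⁻¹)^[N] x) = (L ^ (-(N : ℤ))).mulVec (toReal x) -
      deviation Q L N ((backwardMatrix L N).mulVec (toReal x)) := by
  induction N with
  | zero => simp [deviation]
  | succ N ih =>
    rw [Function.iterate_succ_apply', transition, ih, deviation, initBlocks_backwardMatrix_mulVec,
      lastBlock_backwardMatrix_mulVec hL, Matrix.mulVec_sub]
    have : L⁻¹.mulVec ((L ^ (-(N : ℤ))).mulVec (toReal x)) =
        (L ^ (-((N + 1 : ℕ) : ℤ))).mulVec (toReal x) := by
      rw [← lastBlock_backwardMatrix_mulVec hL]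
      push_cast
      rfl
    rw [this, sub_sub_cancel]

/-- A point y is an (N+1)-step preimage of x exactly when T(y) is an N-step one. With w = T̃^N(x)
and y = z + T̃(w), one gets T(y) - w = R(L(z - e)), e being the error at L⁻¹w. -/
lemma basinSet_succ (hR : IsQuantizer R) (hL : L.det ≠ 0) (N : ℕ) (x : Fin n → ℤ) :
    basinSet R L (N + 1) x = latticeStep R L (basinSet R L N x)
      (frac (compQuantizer R L) (L⁻¹.mulVec (toReal ((compTransition R L)^[N] x)))) := by
  have hmem : ∀ M z, z ∈ basinSet R L M x ↔
      (transition R L)^[M] (z + (compTransition R L)^[M] x) = x := by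
    intro M z
    constructor
    · rintro ⟨y, hy, rfl⟩
      simpa using hy
    · exact fun h => ⟨_, h, by simp⟩
  ext z
  rw [mem_latticeStep_iff hR hL, hmem, hmem, Function.iterate_succ_apply,
    Function.iterate_succ_apply']
  set w := (compTransition R L)^[N] x
  have : transition R L (z + compTransition R L w) =
      R (L.mulVec (toReal z - frac (compQuantizer R L) (L⁻¹.mulVec (toReal w)))) + w := by
    rw [transition, ← hR.map_add]
    congr 1
    rw [frac, compTransition, transition, toReal_add, ← sub_add, sub_add_eq_add_sub,
      Matrix.mulVec_sub, Matrix.mulVec_mulVec,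
      Matrix.mul_nonsing_inv _ hL.isUnit, Matrix.one_mulVec, sub_add_cancel]
  rw [this]

lemma basinSet_zero (x : Fin n → ℤ) : basinSet R L 0 x = {0} := by
  simp [basinSet]

lemma basinSet_eq_basinLift (hR : IsQuantizer R) (hL : L.det ≠ 0) (N : ℕ) (x : Fin n → ℤ) :
    basinSet R L N x =
      basinLift R (compQuantizer R L) L N ((backwardMatrix L N).mulVec (toReal x)) := by
  induction N with
  | zero => exact basinSet_zero x
  | succ N ih =>
    rw [basinSet_succ hR hL, ih, basinLift, initBlocks_backwardMatrix_mulVec,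
      lastBlock_backwardMatrix_mulVec hL, compTransition, toReal_iterate_transition hL,
      Matrix.mulVec_sub]

/-! ### Nonresonance, adaptedness and the Markov property -/

lemma IterativelyNonresonant.backwardMatrix (hL : IterativelyNonresonant L) (N : ℕ) :
    Nonresonant (backwardMatrix L N) := by
  set e : Fin N × Fin n ≃ Fin (Fintype.card (Fin N × Fin n)) := Fintype.equivFin _
  set s : Fin (Fintype.card (Fin N × Fin n)) → {j : ℤ // j ≠ 0} × Fin n := fun i =>
    (⟨-(((e.symm i).1 : ℕ) + 1 : ℤ), by omega⟩, (e.symm i).2) with hs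
  have hinj : Function.Injective s := by
    intro i j hij
    simp only [hs, Prod.mk.injEq, Subtype.mk.injEq] at hij
    apply e.symm.injective
    refine Prod.ext (Fin.ext ?_) hij.2
    have := hij.1
    omega
  have h := (hL.2 _ s hinj).comp (Sum.map id e) (Function.injective_id.sumMap e.injective)
  have h2 : (Matrix.fromRows (1 : Matrix (Fin n) (Fin n) ℝ)
      ((powersMatrix L).submatrix s id)).row ∘ Sum.map id e =
      (Matrix.fromRows (1 : Matrix (Fin n) (Fin n) ℝ)
        (QuantizedLinear.backwardMatrix L N)).row := by
    funext r j
    rcases r with r | r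
    · rfl
    · change powersMatrix L (s (e r)) j = QuantizedLinear.backwardMatrix L N r j
      simp only [hs, Equiv.symm_apply_apply]
      rfl
  rwa [h2] at h

lemma backwardAlgebra_mono (L : Matrix (Fin n) (Fin n) ℝ) (N : ℕ) :
    backwardAlgebra L N ⊆ backwardAlgebra L (N + 1) := by
  intro E hE
  obtain ⟨P, hP, hP', rfl⟩ := mem_quasiperiodicAlgebra_iff.1 hE
  refine mem_quasiperiodicAlgebra_iff.2 ⟨fun y => P (initBlocks y), fun y z => ?_,
    hP'.comp_initBlocks, rfl⟩
  simp only [initBlocks_add_toReal, hP (initBlocks y)]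

lemma basinSet_mem_backwardAlgebra (hR : IsQuantizer R) (hL : L.det ≠ 0) (N : ℕ)
    (B : Set (Fin n → ℤ)) : {x | basinSet R L N x = B} ∈ backwardAlgebra L N := by
  have hQ := hR.compQuantizer L
  refine mem_quasiperiodicAlgebra_iff.2
    ⟨fun y => basinLift R (compQuantizer R L) L N y = B, fun y z => ?_,
      (aeLocConst_basinLift hR hQ hL N).eq_const B, ?_⟩
  · simp only [periodic_basinLift hQ N y z]
  · simp only [basinSet_eq_basinLift hR hL]

/-- The Markov property of the sets `Σ_N`. -/
theorem hasFrequency_basinSet_succ (hR : IsQuantizer R) (hL : IterativelyNonresonant L) (N : ℕ)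
    {E : Set (Fin n → ℤ)} (hE : E ∈ backwardAlgebra L N) (B C : Finset (Fin n → ℤ)) {p : ℝ}
    (hp : HasFrequency (E ∩ {x | basinSet R L N x = B}) p) :
    HasFrequency (E ∩ {x | basinSet R L N x = B} ∩ {x | basinSet R L (N + 1) x = C})
      (p * kernel R L B C) := by
  have hQ := hR.compQuantizer L
  set Q := compQuantizer R L
  obtain ⟨P, hP, hP', hPE⟩ := mem_quasiperiodicAlgebra_iff.1
    ((isSetAlgebra_quasiperiodicAlgebra (backwardMatrix L N)).inter_mem hE
      (basinSet_mem_backwardAlgebra hR hL.1 N B))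
  rw [hPE] at hp ⊢
  -- Frequencies are unique, so p is the volume given by equidistribution.
  obtain rfl := hp.unique ((hL.backwardMatrix N).hasFrequency hP hP')
  set D : (Fin n → ℝ) → Prop := fun u => latticeStep R L B (frac Q u) = C with hD
  have hD1 : Periodic D := fun u z => by simp only [hD, hQ.periodic_frac u z]
  have hD2 : AELocConst D := (aeLocConst_latticeStep hR hL.1 B.finite_toSet hQ).eq_const _
  have hc := ae_continuousAt_mulVec L⁻¹ (ae_continuousAt_deviation (L := L) hQ N)
  set c : (Fin N × Fin n → ℝ) → Fin n → ℝ := fun y => L⁻¹.mulVec (deviation Q L N y) with hcdef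
  -- On the event `P` the current set is the fixed B, so the next one depends only on the last block
  -- shifted by c of the earlier blocks.
  have hset : {x | P ((backwardMatrix L N).mulVec (toReal x))} ∩
      {x | basinSet R L (N + 1) x = C} =
      {x | (fun y : Fin (N + 1) × Fin n → ℝ => P (initBlocks y) ∧
        D (lastBlock y - c (initBlocks y))) ((backwardMatrix L (N + 1)).mulVec (toReal x))} := by
    ext x
    simp only [Set.mem_inter_iff, Set.mem_ofPred_eq, initBlocks_backwardMatrix_mulVec]
    refine and_congr_right fun hx => ?_
    have hxB : basinSet R L N x = B := by
      have : x ∈ E ∩ {x | basinSet R L N x = B} := by rw [hPE]; exact hx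
      exact this.2
    rw [basinSet_succ hR hL.1, hxB, compTransition, toReal_iterate_transition hL.1,
      Matrix.mulVec_sub, ← lastBlock_backwardMatrix_mulVec hL.1]
  have hskew := (AELocConst.skew hc (AELocConst.const ()) (h := fun _ u => D u)
    fun _ => hD2).comp_splitBlocks
  rw [hset]
  convert (hL.backwardMatrix (N + 1)).hasFrequency ?_ (hP'.comp_initBlocks.and hskew) using 1
  · rw [kernel_eq, Measure.real, Measure.real, Measure.real, ← ENNReal.toReal_mul,
      ← volume_skew hc (hP'.and (aeLocConst_floorPi.eq_const 0)) hQ.equivariant hQ.aeLocConst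
        hD1 hD2]
    congr 1
    rw [← (measurePreserving_splitBlocks N n).measure_preimage]
    · congr 1
      ext y
      simp only [Set.mem_preimage, Set.mem_ofPred_eq, floorPi_eq_zero_iff_blocks]
      tauto
    · exact (AELocConst.skew_and_floorPi hc (hP'.and (aeLocConst_floorPi.eq_const 0))
        hD2).nullMeasurableSet
  · intro y z
    simp only [initBlocks_add_toReal, lastBlock_add_toReal, hP (initBlocks y),
      add_sub_right_comm, hcdef, periodic_deviation hQ N (initBlocks y), hD1 _ _]

lemma hasFrequency_univ (n : ℕ) : HasFrequency (Set.univ : Set (Fin n → ℤ)) 1 := by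
  refine tendsto_const_nhds.congr' ?_
  filter_upwards [eventually_boxFinset_nonempty n] with q hq
  rw [fraction, Set.univ_inter, ← coe_boxFinset, Set.ncard_coe_finset, div_self]
  exact_mod_cast hq.card_pos.ne'

theorem isHomogeneousMarkovChain_basinSet (hR : IsQuantizer R) (hL : IterativelyNonresonant L) :
    IsHomogeneousMarkovChain (backwardAlgebra L) (basinSet R L) (kernel R L) where
  algebra N _ := isSetAlgebra_quasiperiodicAlgebra _
  mono N _ := backwardAlgebra_mono L N
  measurable N _ E hE := by
    obtain ⟨P, hP, hP', rfl⟩ := mem_quasiperiodicAlgebra_iff.1 hE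
    exact ⟨_, (hL.backwardMatrix N).hasFrequency hP hP'⟩
  kernel_nonneg A B := measureReal_nonneg
  kernel_sum A := hasSum_kernel hR hL.1 A
  finite N _ x := by
    rw [basinSet_eq_basinLift hR hL.1]
    exact finite_basinLift hR N _
  adapted N _ B := basinSet_mem_backwardAlgebra hR hL.1 N B
  markov N _ E hE B C p hp := hasFrequency_basinSet_succ hR hL N hE B C hp

/-- The Markov step is applied with the path event itself as E. It is valid from time 0, where Σ_0 =
{0} surely, and this supplies the first factor. -/
theorem basinSet_path_frequency (hR : IsQuantizer R) (hL : IterativelyNonresonant L)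
    {B : ℕ → Finset (Fin n → ℤ)} (hB : B 0 = {0}) (N : ℕ) :
    {x | ∀ k, 1 ≤ k → k ≤ N → basinSet R L k x = B k} ∈ backwardAlgebra L N ∧
      HasFrequency {x | ∀ k, 1 ≤ k → k ≤ N → basinSet R L k x = B k}
        (∏ k ∈ Finset.Icc 1 N, kernel R L (B (k - 1)) (B k)) := by
  induction N with
  | zero =>
    have h : {x | ∀ k, 1 ≤ k → k ≤ 0 → basinSet R L k x = B k} = Set.univ := by
      ext x
      simp only [Set.mem_ofPred_eq, Set.mem_univ, iff_true]
      intro k hk hk'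
      omega
    rw [h]
    exact ⟨(isSetAlgebra_quasiperiodicAlgebra _).univ_mem, by simpa using hasFrequency_univ n⟩
  | succ N ih =>
    have h1 : {x | ∀ k, 1 ≤ k → k ≤ N → basinSet R L k x = B k} ∩ {x | basinSet R L N x = B N} =
        {x | ∀ k, 1 ≤ k → k ≤ N → basinSet R L k x = B k} := by
      refine Set.inter_eq_left.2 fun x hx => ?_
      rcases Nat.eq_zero_or_pos N with rfl | hN
      · simp [basinSet_zero, hB]
      · exact hx N hN le_rfl
    have h2 : {x | ∀ k, 1 ≤ k → k ≤ N + 1 → basinSet R L k x = B k} =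
        {x | ∀ k, 1 ≤ k → k ≤ N → basinSet R L k x = B k} ∩
          {x | basinSet R L (N + 1) x = B (N + 1)} := by
      ext x
      constructor
      · exact fun h => ⟨fun k hk hk' => h k hk (by omega), h _ (by omega) le_rfl⟩
      · rintro ⟨h, h'⟩ k hk hk'
        rcases Nat.lt_or_ge N k with hlt | hge
        · obtain rfl : k = N + 1 := by omega
          exact h'
        · exact h k hk hge
    rw [h2]
    refine ⟨(isSetAlgebra_quasiperiodicAlgebra _).inter_mem (backwardAlgebra_mono L N ih.1)
      (basinSet_mem_backwardAlgebra hR hL.1 (N + 1) _), ?_⟩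
    have := hasFrequency_basinSet_succ hR hL N ih.1 (B N) (B (N + 1)) (by rw [h1]; exact ih.2)
    rw [h1] at this
    rwa [Finset.prod_Icc_succ_top (by omega), Nat.add_sub_cancel]

end Lift

end QuantizedLinear

theorem mainTheorem6 {n : ℕ} (R : (Fin n → ℝ) → (Fin n → ℤ)) (hR : QuantizedLinear.IsQuantizer R)
    (L : Matrix (Fin n) (Fin n) ℝ) (hL : QuantizedLinear.IterativelyNonresonant L) :
    QuantizedLinear.IsHomogeneousMarkovChain (QuantizedLinear.backwardAlgebra L)
        (QuantizedLinear.basinSet R L) (QuantizedLinear.kernel R L) ∧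
      ∀ N : ℕ, 1 ≤ N → ∀ B : ℕ → Finset (Fin n → ℤ), B 0 = {0} →
        {x | ∀ k, 1 ≤ k → k ≤ N → QuantizedLinear.basinSet R L k x = ↑(B k)} ∈
            QuantizedLinear.backwardAlgebra L N ∧
          QuantizedLinear.HasFrequency
            {x | ∀ k, 1 ≤ k → k ≤ N → QuantizedLinear.basinSet R L k x = ↑(B k)}
            (∏ k ∈ Finset.Icc 1 N, QuantizedLinear.kernel R L (B (k - 1)) (B k)) :=
  ⟨QuantizedLinear.isHomogeneousMarkovChain_basinSet hR hL,
    fun N _ _ hB => QuantizedLinear.basinSet_path_frequency hR hL hB N⟩
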